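/- Let $S^1=\mathbb R/2\pi\mathbb Z$, $z=e^{i\theta}$, and let $w\in W^{1,\infty}(S^1)$ be real-valued with $0<w_-\le w\le w_+<\infty$ a.e. Let $L^2(w)=L^2(S^1,w\,\frac{d\theta}{2\pi})$ with inner product $\langle f,g\rangle_w=\int f\overline g\,w\,\frac{d\theta}{2\pi}$, and for $\lambda>0$ and $f,g\in H^1(S^1)$ put $$\langle f,g\rangle_{w,\lambda}=\int f\overline g\,w\,\frac{d\theta}{2\pi}+\lambda\int f'\,\overline{g'}\,\frac{d\theta}{2\pi}.$$ For $N\in\mathbb N=\{0,1,2,\dots\}$ let $\mathcal A_{\le N}=\mathrm{span}\{1,z,\dots,z^N\}$, and let $(\varphi^{(0)}_k)_{k=0}^N$ and $(\varphi^{(\lambda)}_k)_{k=0}^N$ be the orthonormal polynomials obtained from $(1,z,\dots,z^N)$ by Gram–Schmidt with respect to $\langle\cdot,\cdot\rangle_w$ and $\langle\cdot,\cdot\rangle_{w,\lambda}$ respectively. Let $P^{(0)}$ be the orthogonal projector of $L^2(w)$ onto $\mathcal A_{\le N}$, and let $P^{(\lambda)}$ be the orthogonal projector onto $\mathcal A_{\le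 N}$ for the Sobolev geometry, i.e. the bounded operator on $L^2(w)$ with values in $\mathcal A_{\le N}$ such that $\langle f-P^{(\lambda)}f,g\rangle_{w,\lambda}=0$ for all $f\in H^1(S^1)$, $g\in\mathcal A_{\le N}$. Put $C_N(w)=N^4\,(w_-^{-2}w_++w_-^{-1})$. There is an absolute constant $K>0$ such that for all such $w,w_-,w_+$ and all $N$ there is a constant $\widetilde C_N(w)\ge 0$ with $\widetilde C_N(w)\le K\,C_N(w)$, and $\widetilde C_N(w)>0$ if $N\ge1$, for which the following holds. 1. For every $\lambda>0$ the operator $P^{(\lambda)}$ exists, is unique, and satisfies $\|P^{(\lambda)}-P^{(0)}\|_{\mathcal B(L^2(w))}\le\widetilde C_N(w)\,\lambda$. 2. There is a unitary matrix $U_N\in U(N+1)$ such that for every $\lambda>0$ $$\max_{0\le k\le N}\Big\|\varphi^{(\lambda)}_k-\sum_{j=0}^N(U_N)_{kj}\,\varphi^{(0)}_j\Big\|_{L^2(w)}\le\widetilde C_N(w)\,\lambda.$$ -/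

import Mathlib

open MeasureTheory AddCircle
open scoped ComplexConjugate ContDiff

noncomputable section

namespace SobolevOPUC

instance twoPiPos : Fact (0 < 2 * Real.pi) := ⟨Real.two_pi_pos⟩

/-- The unit circle, parametrised by the angle `θ ∈ ℝ / 2πℤ`. Its measure `haarAddCircle` is the
normalised measure `dθ / 2π`, and `fourier n` is the function `z ^ n = exp (i n θ)`. -/
abbrev S1 : Type := AddCircle (2 * Real.pi)

/-- The classical derivative `∂_θ φ`. -/
def angleDeriv (φ : S1 → ℂ) (x : S1) : ℂ :=
  deriv (fun t : ℝ => φ (x + (t : S1))) 0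

/-- `φ` is a smooth function on the circle. -/
def IsTestFunction (φ : S1 → ℂ) : Prop :=
  ContDiff ℝ ∞ (fun t : ℝ => φ (t : S1))

/-- `g` is a weak derivative of `f` on the circle (for `f` and `g` integrable). -/
def HasWeakDeriv (f g : S1 → ℂ) : Prop :=
  ∀ φ : S1 → ℂ, IsTestFunction φ →
    ∫ x, f x * angleDeriv φ x ∂haarAddCircle = -∫ x, g x * φ x ∂haarAddCircle

/-- `w ∈ W^{1,∞}(S¹)`, for real-valued `w`. -/
def MemW1Inf (w : S1 → ℝ) : Prop :=
  MemLp w ⊤ haarAddCircle ∧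
    ∃ w' : S1 → ℝ, MemLp w' ⊤ haarAddCircle ∧
      HasWeakDeriv (fun x => (w x : ℂ)) (fun x => (w' x : ℂ))

/-- `f ∈ H¹(S¹)`. -/
def MemH1 (f : S1 → ℂ) : Prop :=
  MemLp f 2 haarAddCircle ∧ ∃ g : S1 → ℂ, MemLp g 2 haarAddCircle ∧ HasWeakDeriv f g

open Classical in
/-- The weak derivative of a function in `H¹(S¹)` (determined almost everywhere), and `0` for
functions that are not in `H¹(S¹)`. -/
def weakDeriv (f : S1 → ℂ) : S1 → ℂ :=
  if h : MemH1 f then h.2.choose else 0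

/-- A weight `w ∈ W^{1,∞}(S¹)` together with constants `0 < w₋ ≤ w ≤ w₊ < ∞`. -/
structure Weight where
  /-- the density -/
  w : S1 → ℝ
  /-- the lower bound `w₋` -/
  lower : ℝ
  /-- the upper bound `w₊` -/
  upper : ℝ
  memW1Inf : MemW1Inf w
  lower_pos : 0 < lower
  lower_le : ∀ᵐ x ∂haarAddCircle, lower ≤ w x
  le_upper : ∀ᵐ x ∂haarAddCircle, w x ≤ upper

/-- The measure `dμ = w dθ / 2π`. -/
def Weight.measure (W : Weight) : Measure S1 :=
  haarAddCircle.withDensity (fun x => ENNReal.ofReal (W.w x))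

instance (W : Weight) : IsFiniteMeasure W.measure :=
  isFiniteMeasure_withDensity_ofReal (W.memW1Inf.1.integrable le_top).2

/-- The Hilbert space `L²(w) = L²(S¹, w dθ / 2π)`. Mathlib's `inner ℂ g f` on it is
`⟨f, g⟩_w = ∫ f * conj g * w dθ / 2π`. -/
abbrev L2 (W : Weight) : Type := Lp ℂ 2 W.measure

/-- The monomial `z ^ k` as an element of `L²(w)`. -/
def monomial (W : Weight) (k : ℕ) : L2 W :=
  ContinuousMap.toLp 2 W.measure ℂ (fourier (k : ℤ))

/-- The space `span {1, z, …, z ^ N}`. -/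
def analyticModes (W : Weight) (N : ℕ) : Submodule ℂ (L2 W) :=
  Submodule.span ℂ ((fun k : ℕ => monomial W k) '' Set.Iic N)

instance (W : Weight) (N : ℕ) : FiniteDimensional ℂ (analyticModes W N) :=
  FiniteDimensional.span_of_finite ℂ ((Set.finite_Iic N).image _)

/-- The mixed Sobolev inner product
`⟨f, g⟩_{w,lam} = ∫ f * conj g * w dθ / 2π + lam * ∫ f' * conj g' dθ / 2π` (for `f, g` in `H¹`). -/
def sobolevInner (W : Weight) (lam : ℝ) (f g : L2 W) : ℂ :=
  ∫ x, f x * conj (g x) * (W.w x : ℂ) ∂haarAddCircle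
    + (lam : ℂ) * ∫ x, weakDeriv f x * conj (weakDeriv g x) ∂haarAddCircle

/-- Gram–Schmidt orthogonalisation of the sequence `v` for the sesquilinear form `B` (linear in
its first argument), without normalisation. -/
def gramSchmidtForm {V : Type*} [AddCommGroup V] [Module ℂ V] (B : V → V → ℂ) (v : ℕ → V) :
    ℕ → V
  | k => v k - ∑ i : Fin k,
      (B (v k) (gramSchmidtForm B v i) / B (gramSchmidtForm B v i) (gramSchmidtForm B v i)) •
        gramSchmidtForm B v i
decreasing_by all_goals exact i.isLt

/-- Gram–Schmidt orthonormalisation of the sequence `v` for the sesquilinear form `B`. -/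
def gramSchmidtFormNormed {V : Type*} [AddCommGroup V] [Module ℂ V] (B : V → V → ℂ) (v : ℕ → V)
    (k : ℕ) : V :=
  ((Real.sqrt (B (gramSchmidtForm B v k) (gramSchmidtForm B v k)).re : ℂ))⁻¹ •
    gramSchmidtForm B v k

/-- The orthonormal polynomials `φ_k^{(0)}` of `⟨·,·⟩_w`. -/
def opuc (W : Weight) (k : ℕ) : L2 W :=
  InnerProductSpace.gramSchmidtNormed ℂ (monomial W) k

/-- The orthonormal polynomials `φ_k^{(lam)}` of `⟨·,·⟩_{w,lam}`. -/
def sobolevOpuc (W : Weight) (lam : ℝ) (k : ℕ) : L2 W :=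
  gramSchmidtFormNormed (sobolevInner W lam) (monomial W) k

/-- `P`, a bounded operator on `L²(w)`, is the orthogonal projector onto `span {1, z, …, z ^ N}`
for the Sobolev geometry: it takes values in that space, and for every `f ∈ H¹(S¹)` the difference
`f - P f` is `⟨·,·⟩_{w,lam}`-orthogonal to it. (By density of `H¹(S¹)` in `L²(w)` there is only one
such `P`.) -/
def IsSobolevProjector (W : Weight) (lam : ℝ) (N : ℕ) (P : L2 W →L[ℂ] L2 W) : Prop :=
  (∀ f : L2 W, P f ∈ analyticModes W N) ∧
    ∀ f : L2 W, MemH1 f → ∀ g ∈ analyticModes W N, sobolevInner W lam (f - P f) g = 0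

/-- The explicit constant `C_N(w) = N⁴ (w₋⁻² w₊ + w₋⁻¹)`. -/
def finiteDegreeConst (W : Weight) (N : ℕ) : ℝ :=
  (N : ℝ) ^ 4 * (W.upper / W.lower ^ 2 + 1 / W.lower)

end SobolevOPUC

end

/-! Differentiation is unbounded on `L²(w)`, but against a polynomial of degree at most `N` it acts
as a bounded operator. By Parseval, if `g` lies in the span of `1, …, z ^ N` and `f` is in `H¹`,
then `∫ f' conj g'` involves only the coefficients of orders `0, …, N`. It therefore equals `⟨J f, J
g⟩` with `J f = (n a_n(f))`, and `‖J f‖² ≤ M ‖f‖²` for `M = N² / w₋`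
(`sobolevInner_eq_perturbedInner`, `norm_sq_modeDerivLinear_le`).

What remains is the bounded perturbation `B(f, g) = ⟨f, g⟩ + lam ⟨J f, J g⟩` in an inner product
space. An energy estimate (`norm_le_of_forall_perturbedInner_eq`) bounds the change of the projector
by `M lam`. Together with Pythagoras in both geometries it bounds the change of each orthonormal
polynomial by `2 M lam` (`norm_normalized_sub_le`). Neither bound needs `lam` small, the unitary
matrix is the identity, and `N² ≤ N⁴` gives `M ≤ C_N(w)`. -/

noncomputable section
namespace SobolevOPUC

/-! ### Bounded perturbations of an inner product: projectors. -/

section Abstract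

variable {E F G : Type*} [NormedAddCommGroup E] [InnerProductSpace ℂ E]
  [NormedAddCommGroup F] [InnerProductSpace ℂ F] [NormedAddCommGroup G] [InnerProductSpace ℂ G]

/-- The perturbation `⟨f, g⟩ + lam ⟨J f, J g⟩` of the inner product, linear in `f`. -/
def perturbedInner (J : E →L[ℂ] F) (lam : ℝ) (f g : E) : ℂ :=
  inner ℂ g f + (lam : ℂ) * inner ℂ (J g) (J f)

/-- The map `f ↦ (f, √lam J f)`, an isometry from the perturbed inner product. -/
def graphMap (J : E →L[ℂ] F) (lam : ℝ) : E →L[ℂ] WithLp 2 (E × F) :=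
  (WithLp.prodContinuousLinearEquiv 2 ℂ E F).symm.toContinuousLinearMap ∘L
    (ContinuousLinearMap.id ℂ E).prod ((Real.sqrt lam : ℂ) • J)

lemma inner_graphMap (J : E →L[ℂ] F) {lam : ℝ} (hlam : 0 ≤ lam) (f g : E) :
    inner ℂ (graphMap J lam g) (graphMap J lam f) = perturbedInner J lam f g := by
  have h : (Real.sqrt lam : ℂ) * Real.sqrt lam = lam := by
    rw [← Complex.ofReal_mul, Real.mul_self_sqrt hlam]
  simp only [graphMap, perturbedInner, WithLp.prod_inner_apply]
  simp [-Complex.coe_smul, inner_smul_left, inner_smul_right, ← mul_assoc, h]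

lemma graphMap_injective (J : E →L[ℂ] F) (lam : ℝ) : Function.Injective (graphMap J lam) := by
  intro f g h
  have := congrArg (fun z : WithLp 2 (E × F) => z.fst) h
  simpa [graphMap] using this

lemma perturbedInner_sub_left (J : E →L[ℂ] F) (lam : ℝ) (f f' g : E) :
    perturbedInner J lam (f - f') g = perturbedInner J lam f g - perturbedInner J lam f' g := by
  simp only [perturbedInner, map_sub, inner_sub_right]
  ring

lemma re_perturbedInner_self (J : E →L[ℂ] F) (lam : ℝ) (f : E) :
    (perturbedInner J lam f f).re = ‖f‖ ^ 2 + lam * ‖J f‖ ^ 2 := by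
  simp only [perturbedInner, inner_self_eq_norm_sq_to_K, Complex.add_re, Complex.coe_algebraMap,
    Complex.re_ofReal_mul]
  norm_cast

lemma eq_zero_of_perturbedInner_self (J : E →L[ℂ] F) {lam : ℝ} (hlam : 0 ≤ lam) {f : E}
    (h : perturbedInner J lam f f = 0) : f = 0 := by
  rw [← inner_graphMap J hlam, inner_self_eq_zero] at h
  exact graphMap_injective J lam (by rw [h, map_zero])

/-- Energy estimate: take real parts, drop `lam ‖J q‖²`, apply Cauchy–Schwarz and divide by `‖q‖`.
-/
lemma norm_le_of_forall_perturbedInner_eq (J : E →L[ℂ] F) {lam M : ℝ} (hlam : 0 ≤ lam)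
    (hJ : ∀ f, ‖J f‖ ^ 2 ≤ M * ‖f‖ ^ 2) (q h : E)
    (hq : perturbedInner J lam q q = lam * inner ℂ (J q) (J h)) :
    ‖q‖ ≤ lam * M * ‖h‖ := by
  have h1 : ‖q‖ ^ 2 ≤ lam * (‖J q‖ * ‖J h‖) := by
    have h2 := congrArg Complex.re hq
    rw [re_perturbedInner_self, Complex.re_ofReal_mul] at h2
    have h3 : (inner ℂ (J q) (J h)).re ≤ ‖J q‖ * ‖J h‖ :=
      (Complex.re_le_norm _).trans (norm_inner_le_norm _ _)
    nlinarith [mul_le_mul_of_nonneg_left h3 hlam, mul_nonneg hlam (sq_nonneg ‖J q‖)]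
  -- The sign of `M` can be read off from `hJ` only at a nonzero vector.
  rcases eq_or_lt_of_le (norm_nonneg q) with hq0 | hq0
  · rcases eq_or_lt_of_le (norm_nonneg h) with hh0 | hh0
    · rw [← hq0, ← hh0, mul_zero]
    · have hM : 0 ≤ M := nonneg_of_mul_nonneg_left ((sq_nonneg _).trans (hJ h)) (by positivity)
      rw [← hq0]
      positivity
  · have hM : 0 ≤ M := nonneg_of_mul_nonneg_left ((sq_nonneg _).trans (hJ q)) (by positivity)
    have h2 : ‖J q‖ * ‖J h‖ ≤ M * (‖q‖ * ‖h‖) := by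
      refine abs_le_of_sq_le_sq' ?_ (by positivity) |>.2
      calc (‖J q‖ * ‖J h‖) ^ 2 = ‖J q‖ ^ 2 * ‖J h‖ ^ 2 := by ring
        _ ≤ (M * ‖q‖ ^ 2) * (M * ‖h‖ ^ 2) :=
          mul_le_mul (hJ q) (hJ h) (by positivity) (by positivity)
        _ = (M * (‖q‖ * ‖h‖)) ^ 2 := by ring
    have h4 := h1.trans (mul_le_mul_of_nonneg_left h2 hlam)
    refine le_of_mul_le_mul_left ?_ hq0
    linarith

/-- The orthogonal projector for the perturbed inner product. -/
lemma exists_perturbed_projector (J : E →L[ℂ] F) {lam M : ℝ} (hlam : 0 ≤ lam)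
    (hM : 0 ≤ M) (hJ : ∀ f, ‖J f‖ ^ 2 ≤ M * ‖f‖ ^ 2) (V : Submodule ℂ E) [FiniteDimensional ℂ V] :
    ∃ P : E →L[ℂ] E, (∀ f, P f ∈ V) ∧
      (∀ f, ∀ g ∈ V, perturbedInner J lam (f - P f) g = 0) ∧
      ‖P - V.starProjection‖ ≤ M * lam := by
  let A := graphMap J lam
  -- `A` carries the perturbed form to a genuine inner product, so the projector is the pullback of
  -- the orthogonal projection onto `A(V)`.
  let e : V ≃ₗ[ℂ] V.map A.toLinearMap :=
    Submodule.equivMapOfInjective A.toLinearMap (graphMap_injective J lam) V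
  have he : ∀ y : V.map A.toLinearMap, A (e.symm y) = y := fun y => by
    conv_rhs => rw [← e.apply_symm_apply y]
    rfl
  let P : E →L[ℂ] E := V.subtypeL ∘L e.symm.toContinuousLinearEquiv.toContinuousLinearMap ∘L
    (V.map A.toLinearMap).orthogonalProjectionOnto ∘L A
  have hmem : ∀ f, P f ∈ V := fun f => (e.symm _).2
  have hAP : ∀ f, A (P f) = (V.map A.toLinearMap).starProjection (A f) := fun f => he _
  have horth : ∀ f, ∀ g ∈ V, perturbedInner J lam (f - P f) g = 0 := fun f g hg => by
    rw [← inner_graphMap J hlam, map_sub]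
    change inner ℂ (A g) (A f - A (P f)) = 0
    rw [hAP]
    exact (Submodule.mem_orthogonal _ _).1
      ((V.map A.toLinearMap).sub_starProjection_mem_orthogonal (A f)) _ ⟨g, hg, rfl⟩
  refine ⟨P, hmem, horth, ContinuousLinearMap.opNorm_le_bound _ (by positivity) fun f => ?_⟩
  have hsub : ‖f - V.starProjection f‖ ≤ ‖f‖ := by
    have h1 : f - V.starProjection f = Vᗮ.starProjection f := by
      rw [Submodule.starProjection_orthogonal_val]
    rw [h1]
    exact Vᗮ.norm_starProjection_apply_le f
  -- Each residual is orthogonal to `V` in its own geometry, so only the `J` term survives.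
  have hq : ∀ g ∈ V, perturbedInner J lam (P f - V.starProjection f) g
      = lam * inner ℂ (J g) (J (f - V.starProjection f)) := fun g hg => by
    have h1 : P f - V.starProjection f = (f - V.starProjection f) - (f - P f) := by abel
    have h2 : inner ℂ g (f - V.starProjection f) = 0 := (Submodule.mem_orthogonal _ _).1
      (V.sub_starProjection_mem_orthogonal f) g hg
    rw [h1, perturbedInner_sub_left, horth f g hg, sub_zero, perturbedInner, h2, zero_add]
  have := norm_le_of_forall_perturbedInner_eq J hlam hJ _ _
    (hq _ (V.sub_mem (hmem f) (V.starProjection_apply_mem f)))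
  calc ‖(P - V.starProjection) f‖ ≤ lam * M * ‖f - V.starProjection f‖ := this
    _ ≤ lam * M * ‖f‖ := by gcongr
    _ = M * lam * ‖f‖ := by ring

/-! ### Gram–Schmidt for a perturbed inner product. -/

lemma gramSchmidtForm_eq (B : E → E → ℂ) (v : ℕ → E) (k : ℕ) :
    gramSchmidtForm B v k = v k - ∑ i ∈ Finset.range k,
      (B (v k) (gramSchmidtForm B v i) / B (gramSchmidtForm B v i) (gramSchmidtForm B v i)) •
        gramSchmidtForm B v i := by
  rw [gramSchmidtForm, Finset.sum_range]

lemma gramSchmidtForm_sub_mem_span (B : E → E → ℂ) (v : ℕ → E) (k : ℕ) :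
    gramSchmidtForm B v k - v k ∈ Submodule.span ℂ (v '' Set.Iio k) := by
  induction k using Nat.strong_induction_on with
  | _ k ih =>
    rw [gramSchmidtForm_eq, sub_sub_cancel_left]
    refine Submodule.neg_mem _ (Submodule.sum_mem _ fun i hi => Submodule.smul_mem _ _ ?_)
    have hik := Finset.mem_range.1 hi
    rw [← sub_add_cancel (gramSchmidtForm B v i) (v i)]
    refine Submodule.add_mem _ ?_ (Submodule.subset_span ⟨i, hik, rfl⟩)
    exact Submodule.span_mono (Set.image_mono fun j (hj : j < i) => hj.trans hik) (ih i hik)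

lemma gramSchmidtForm_mem (B : E → E → ℂ) (v : ℕ → E) (V : Submodule ℂ E) (k : ℕ)
    (hv : ∀ i ≤ k, v i ∈ V) : gramSchmidtForm B v k ∈ V := by
  rw [← sub_add_cancel (gramSchmidtForm B v k) (v k)]
  refine V.add_mem (Submodule.span_le.2 ?_ (gramSchmidtForm_sub_mem_span B v k)) (hv k le_rfl)
  rintro _ ⟨i, hi, rfl⟩
  exact hv i (le_of_lt hi)

/-- Gram–Schmidt evaluates the form only on the span of the vectors; this lets the Sobolev form be
replaced by its bounded model. -/
lemma gramSchmidtForm_congr {B B' : E → E → ℂ} (v : ℕ → E) (V : Submodule ℂ E)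
    (hB : ∀ f ∈ V, ∀ g ∈ V, B f g = B' f g) (k : ℕ) (hv : ∀ i ≤ k, v i ∈ V) :
    gramSchmidtForm B v k = gramSchmidtForm B' v k := by
  induction k using Nat.strong_induction_on with
  | _ k ih =>
    rw [gramSchmidtForm_eq, gramSchmidtForm_eq]
    congr 1
    refine Finset.sum_congr rfl fun i hi => ?_
    have hik := Finset.mem_range.1 hi
    have hvi : ∀ j ≤ i, v j ∈ V := fun j hj => hv j (hj.trans hik.le)
    have hi' := gramSchmidtForm_mem B' v V i hvi
    rw [ih i hik hvi, hB _ (hv k le_rfl) _ hi', hB _ hi' _ hi']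

/-- A form pulled back along `A` has the Gram–Schmidt coefficients of the image vectors, so
orthogonality transfers from `InnerProductSpace.gramSchmidt`. -/
lemma map_gramSchmidtForm (A : E →ₗ[ℂ] G) {B : E → E → ℂ}
    (hB : ∀ f g, B f g = inner ℂ (A g) (A f)) (v : ℕ → E) (k : ℕ) :
    A (gramSchmidtForm B v k) = InnerProductSpace.gramSchmidt ℂ (A ∘ v) k := by
  induction k using Nat.strong_induction_on with
  | _ k ih =>
    rw [gramSchmidtForm_eq, InnerProductSpace.gramSchmidt_def, map_sub, map_sum, Nat.Iio_eq_range]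
    congr 1
    refine Finset.sum_congr rfl fun i hi => ?_
    rw [map_smul, hB, hB, ih i (Finset.mem_range.1 hi), Submodule.starProjection_singleton,
      inner_self_eq_norm_sq_to_K]
    simp

lemma inner_gramSchmidtForm_eq_zero (A : E →ₗ[ℂ] G) {B : E → E → ℂ}
    (hB : ∀ f g, B f g = inner ℂ (A g) (A f)) (v : ℕ → E) (k : ℕ) (g : E)
    (hg : g ∈ Submodule.span ℂ (v '' Set.Iio k)) : B (gramSchmidtForm B v k) g = 0 := by
  rw [hB, map_gramSchmidtForm A hB, inner_eq_zero_symm]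
  induction hg using Submodule.span_induction with
  | mem x hx =>
    obtain ⟨i, hi, rfl⟩ := hx
    exact InnerProductSpace.gramSchmidt_inv_triangular ℂ (A ∘ v) hi
  | zero => simp
  | add x y _ _ hx hy => rw [map_add, inner_add_right, hx, hy, add_zero]
  | smul a x _ hx => rw [map_smul, inner_smul_right, hx, mul_zero]

/-- Here `p` and `s` play the unnormalised vectors of the two geometries, each orthogonal to `s - p`
in its own. The change of direction and the change of length each cost at most `M lam`. -/
lemma norm_normalized_sub_le (J : E →L[ℂ] F) {lam M : ℝ} (hlam : 0 ≤ lam) (hM : 0 ≤ M)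
    (hJ : ∀ f, ‖J f‖ ^ 2 ≤ M * ‖f‖ ^ 2) {p s : E} (hp : p ≠ 0)
    (hps : inner ℂ (s - p) p = 0) (hs : perturbedInner J lam s (s - p) = 0) :
    ‖((Real.sqrt (perturbedInner J lam s s).re : ℂ))⁻¹ • s - ((‖p‖ : ℂ))⁻¹ • p‖
      ≤ 2 * M * lam := by
  set r := s - p with hr
  set S := Real.sqrt (perturbedInner J lam s s).re with hS
  have hsr : s = p + r := by rw [hr]; abel
  have ha : 0 < ‖p‖ := norm_pos_iff.2 hp
  have hS2 : S ^ 2 = ‖s‖ ^ 2 + lam * ‖J s‖ ^ 2 := by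
    rw [hS, re_perturbedInner_self, Real.sq_sqrt (by positivity)]
  have hnorm : ‖s‖ ^ 2 = ‖p‖ ^ 2 + ‖r‖ ^ 2 := by
    rw [hsr, norm_add_sq (𝕜 := ℂ), inner_eq_zero_symm.1 hps]
    simp
  have hS0 : 0 ≤ S := Real.sqrt_nonneg _
  have hsS : ‖s‖ ≤ S := by
    refine abs_le_of_sq_le_sq' ?_ hS0 |>.2
    rw [hS2]
    nlinarith [mul_nonneg hlam (sq_nonneg ‖J s‖)]
  have haS : ‖p‖ ≤ S := by
    refine (abs_le_of_sq_le_sq' ?_ (norm_nonneg s) |>.2).trans hsS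
    nlinarith [sq_nonneg ‖r‖]
  have hSpos : 0 < S := ha.trans_le haS
  -- Pythagoras for the perturbed form, applied to `p = s - r`, gives `S² ≤ B(p, p)`.
  have hS3 : S ^ 2 ≤ (1 + lam * M) * ‖p‖ ^ 2 := by
    have h1 := re_perturbedInner_self J lam p
    have h2 : perturbedInner J lam p p
        = perturbedInner J lam s s + perturbedInner J lam r r := by
      have hs' : perturbedInner J lam r s = 0 := by
        rw [← inner_graphMap J hlam] at hs ⊢
        exact inner_eq_zero_symm.1 hs
      have hp' : p = s - r := by rw [hr]; abel
      rw [← inner_graphMap J hlam] at hs hs'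
      rw [hp']
      simp only [← inner_graphMap J hlam, map_sub, inner_sub_left, inner_sub_right, hs, hs']
      ring
    rw [h2, Complex.add_re, re_perturbedInner_self, re_perturbedInner_self, ← hS2] at h1
    nlinarith [mul_le_mul_of_nonneg_left (hJ p) hlam, mul_nonneg hlam (sq_nonneg ‖J r‖),
      sq_nonneg ‖r‖]
  -- The two orthogonality relations leave `B(r, r) = -lam ⟨J r, J p⟩`, an instance of the energy
  -- estimate.
  have hrS : ‖r‖ ≤ lam * M * S := by
    refine (norm_le_of_forall_perturbedInner_eq J hlam hJ r (-p) ?_).trans ?_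
    · have h3 : perturbedInner J lam r r
          = perturbedInner J lam s r - perturbedInner J lam p r := by
        rw [← perturbedInner_sub_left]
      rw [h3, hs, perturbedInner, hps]
      simp
    · rw [norm_neg]
      gcongr
  -- `(S - ‖p‖) S ≤ S² - ‖p‖² ≤ lam M ‖p‖² ≤ lam M S²`.
  have hSa : S - ‖p‖ ≤ lam * M * S := by
    refine le_of_mul_le_mul_right ?_ hSpos
    have : lam * M * ‖p‖ ^ 2 ≤ lam * M * S ^ 2 := by gcongr
    nlinarith [mul_nonneg (sub_nonneg.2 haS) ha.le]
  have hdecomp : ((S : ℂ))⁻¹ • s - ((‖p‖ : ℂ))⁻¹ • p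
      = ((S : ℂ))⁻¹ • r + (((S⁻¹ - ‖p‖⁻¹ : ℝ)) : ℂ) • p := by
    rw [hsr, smul_add]
    push_cast
    rw [sub_smul]
    abel
  rw [hdecomp]
  refine (norm_add_le _ _).trans ?_
  have e1 : ‖((S : ℂ))⁻¹ • r‖ ≤ lam * M := by
    rw [norm_smul, norm_inv, Complex.norm_real, Real.norm_of_nonneg hS0, inv_mul_le_iff₀ hSpos]
    linarith
  have e2 : ‖(((S⁻¹ - ‖p‖⁻¹ : ℝ)) : ℂ) • p‖ ≤ lam * M := by
    have : S⁻¹ - ‖p‖⁻¹ ≤ 0 := sub_nonpos.2 (inv_anti₀ ha haS)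
    rw [norm_smul, Complex.norm_real, Real.norm_of_nonpos this]
    have h5 : -(S⁻¹ - ‖p‖⁻¹) * ‖p‖ = S⁻¹ * (S - ‖p‖) := by field_simp; ring
    rw [h5, inv_mul_le_iff₀ hSpos]
    linarith
  linarith

/-- Both unnormalised vectors equal `v k` modulo the span of the earlier `v i`, so their difference
is orthogonal to each in its own geometry. -/
lemma norm_gramSchmidtFormNormed_sub_le (J : E →L[ℂ] F) {lam M : ℝ} (hlam : 0 ≤ lam) (hM : 0 ≤ M)
    (hJ : ∀ f, ‖J f‖ ^ 2 ≤ M * ‖f‖ ^ 2) {v : ℕ → E} (hv : LinearIndependent ℂ v) (k : ℕ) :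
    ‖gramSchmidtFormNormed (perturbedInner J lam) v k
      - InnerProductSpace.gramSchmidtNormed ℂ v k‖ ≤ 2 * M * lam := by
  have h0 : InnerProductSpace.gramSchmidt ℂ v k = gramSchmidtForm (fun f g => inner ℂ g f) v k :=
    (map_gramSchmidtForm (LinearMap.id : E →ₗ[ℂ] E) (fun _ _ => rfl) v k).symm
  have hmem : gramSchmidtForm (perturbedInner J lam) v k - InnerProductSpace.gramSchmidt ℂ v k
      ∈ Submodule.span ℂ (v '' Set.Iio k) := by
    rw [h0]
    simpa using Submodule.sub_mem _ (gramSchmidtForm_sub_mem_span (perturbedInner J lam) v k)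
      (gramSchmidtForm_sub_mem_span (fun f g => inner ℂ g f) v k)
  refine norm_normalized_sub_le J hlam hM hJ (InnerProductSpace.gramSchmidt_ne_zero k hv) ?_ ?_
  · rw [h0] at hmem ⊢
    exact inner_gramSchmidtForm_eq_zero (LinearMap.id : E →ₗ[ℂ] E)
      (B := fun f g => inner ℂ g f) (fun _ _ => rfl) v k _ hmem
  · exact inner_gramSchmidtForm_eq_zero (graphMap J lam).toLinearMap
      (fun f g => (inner_graphMap J hlam f g).symm) v k _ hmem

end Abstract

/-! ### Weak derivatives and Fourier coefficients on the circle. -/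

section Circle

lemma fourier_coe_eq (n : ℤ) (t : ℝ) :
    (fourier n (t : S1) : ℂ) = Complex.exp (Complex.I * n * t) := by
  rw [fourier_coe_apply]
  congr 1
  have : (Real.pi : ℂ) ≠ 0 := by exact_mod_cast Real.pi_ne_zero
  push_cast
  field_simp

lemma hasDerivAt_fourier_coe (n : ℤ) (t : ℝ) :
    HasDerivAt (fun t : ℝ => (fourier n (t : S1) : ℂ)) (Complex.I * n * fourier n (t : S1)) t := by
  simp_rw [fourier_coe_eq]
  have h : HasDerivAt (fun s : ℝ => Complex.I * n * (s : ℂ)) (Complex.I * n) t := by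
    simpa using (Complex.ofRealCLM.hasDerivAt (x := t)).const_mul (Complex.I * n)
  simpa [mul_comm] using h.cexp

lemma isTestFunction_fourier (n : ℤ) : IsTestFunction (fourier n : C(S1, ℂ)) := by
  unfold IsTestFunction
  simp_rw [fourier_coe_eq]
  exact (contDiff_const.mul Complex.ofRealCLM.contDiff).cexp

lemma angleDeriv_coe (φ : S1 → ℂ) (t : ℝ) :
    angleDeriv φ (t : S1) = deriv (fun s : ℝ => φ (s : S1)) t := by
  have h := deriv_comp_const_add (f := fun s : ℝ => φ (s : S1)) t 0
  rw [add_zero] at h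
  rw [← h]
  simp [angleDeriv]

lemma angleDeriv_fourier (n : ℤ) (x : S1) :
    angleDeriv (fourier n : C(S1, ℂ)) x = Complex.I * n * fourier n x := by
  induction x using QuotientAddGroup.induction_on with
  | H t => exact (angleDeriv_coe _ t).trans (hasDerivAt_fourier_coe n t).deriv

lemma integral_haar_eq_intervalIntegral (f : S1 → ℂ) :
    ∫ x, f x ∂haarAddCircle = (1 / (2 * Real.pi)) • ∫ t in (0 : ℝ)..0 + 2 * Real.pi, f (t : S1) := by
  have h := fourierCoeff_eq_intervalIntegral f 0 0
  simpa [fourierCoeff] using h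

/-- Integration by parts over one period; the boundary terms cancel by periodicity. -/
lemma hasWeakDeriv_fourier (n : ℤ) :
    HasWeakDeriv (fourier n : C(S1, ℂ)) (fun x => Complex.I * n * fourier n x) := by
  intro φ hφ
  have hd : ∀ t : ℝ, HasDerivAt (fun s : ℝ => φ (s : S1)) (angleDeriv φ (t : S1)) t := fun t => by
    rw [angleDeriv_coe]
    exact (ContDiff.differentiable hφ (by simp) t).hasDerivAt
  have hc : Continuous fun t : ℝ => angleDeriv φ (t : S1) := by
    simp_rw [angleDeriv_coe]
    exact hφ.continuous_deriv (by simp)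
  have hcφ : Continuous fun t : ℝ => φ (t : S1) := ContDiff.continuous hφ
  have hcf : Continuous fun t : ℝ => (fourier n (t : S1) : ℂ) :=
    (map_continuous (fourier n)).comp (AddCircle.continuous_mk' _)
  have hparts := intervalIntegral.integral_mul_deriv_eq_deriv_mul (a := 0) (b := 0 + 2 * Real.pi)
    (fun t _ => hasDerivAt_fourier_coe n t) (fun t _ => hd t)
    ((continuous_const.mul hcf).intervalIntegrable _ _) (hc.intervalIntegrable _ _)
  rw [integral_haar_eq_intervalIntegral, integral_haar_eq_intervalIntegral, hparts,
    AddCircle.coe_add_period, sub_self, zero_sub, smul_neg]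

/-- Test against `fourier (-n)`. The coefficients do not depend on which weak derivative is chosen,
so the choice in `weakDeriv` is harmless. -/
lemma fourierCoeff_eq_of_hasWeakDeriv {f g : S1 → ℂ} (h : HasWeakDeriv f g) (n : ℤ) :
    fourierCoeff g n = Complex.I * n * fourierCoeff f n := by
  have h1 := h _ (isTestFunction_fourier (-n))
  simp_rw [angleDeriv_fourier] at h1
  simp only [fourierCoeff, smul_eq_mul]
  rw [← neg_eq_iff_eq_neg] at h1
  have h2 : ∫ x, (fourier (-n) x : ℂ) * g x ∂(haarAddCircle : Measure S1)
      = ∫ x, g x * fourier (-n) x ∂haarAddCircle := by simp_rw [mul_comm]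
  rw [h2, ← h1, ← integral_neg, ← integral_const_mul]
  congr 1 with x
  push_cast
  ring

lemma HasWeakDeriv.congr {f f' g g' : S1 → ℂ} (h : HasWeakDeriv f g)
    (hf : f =ᵐ[haarAddCircle] f') (hg : g =ᵐ[haarAddCircle] g') : HasWeakDeriv f' g' := by
  intro φ hφ
  rw [← integral_congr_ae (hf.mono fun x hx => congrArg (· * angleDeriv φ x) hx),
    ← integral_congr_ae (hg.mono fun x hx => congrArg (· * φ x) hx)]
  exact h φ hφ

lemma MemH1.congr {f f' : S1 → ℂ} (h : MemH1 f) (hf : f =ᵐ[haarAddCircle] f') : MemH1 f' := by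
  obtain ⟨h1, g, hg, hfg⟩ := h
  exact ⟨(memLp_congr_ae hf).1 h1, g, hg, hfg.congr hf (by rfl)⟩

lemma IsTestFunction.continuous {φ : S1 → ℂ} (hφ : IsTestFunction φ) : Continuous φ :=
  continuous_coinduced_dom.2 (ContDiff.continuous hφ)

lemma IsTestFunction.continuous_angleDeriv {φ : S1 → ℂ} (hφ : IsTestFunction φ) :
    Continuous (angleDeriv φ) := by
  refine continuous_coinduced_dom.2 ?_
  have : angleDeriv φ ∘ (QuotientAddGroup.mk : ℝ → S1) = deriv (fun s : ℝ => φ (s : S1)) :=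
    funext fun t => angleDeriv_coe φ t
  exact this ▸ ContDiff.continuous_deriv hφ (by simp)

lemma integrable_mul_of_memLp {f φ : S1 → ℂ} (hf : MemLp f 2 haarAddCircle) (hφ : Continuous φ) :
    Integrable (fun x => f x * φ x) haarAddCircle := by
  obtain ⟨c, hc⟩ := (isCompact_range hφ).isBounded.exists_norm_le
  exact (hf.integrable (by norm_num)).mul_bdd (c := c) hφ.aestronglyMeasurable
    (Filter.Eventually.of_forall fun x => hc _ ⟨x, rfl⟩)

lemma MemH1.add {f f' : S1 → ℂ} (h : MemH1 f) (h' : MemH1 f') : MemH1 (f + f') := by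
  obtain ⟨h1, g, hg, hfg⟩ := h
  obtain ⟨h1', g', hg', hfg'⟩ := h'
  refine ⟨h1.add h1', g + g', hg.add hg', fun φ hφ => ?_⟩
  simp only [Pi.add_apply, add_mul]
  rw [integral_add (integrable_mul_of_memLp h1 hφ.continuous_angleDeriv)
      (integrable_mul_of_memLp h1' hφ.continuous_angleDeriv),
    integral_add (integrable_mul_of_memLp hg hφ.continuous)
      (integrable_mul_of_memLp hg' hφ.continuous), hfg φ hφ, hfg' φ hφ]
  ring

lemma MemH1.const_smul {f : S1 → ℂ} (h : MemH1 f) (c : ℂ) : MemH1 (c • f) := by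
  obtain ⟨h1, g, hg, hfg⟩ := h
  refine ⟨h1.const_smul c, c • g, hg.const_smul c, fun φ hφ => ?_⟩
  simp only [Pi.smul_apply, smul_eq_mul, mul_assoc, integral_const_mul]
  rw [hfg φ hφ, mul_neg]

lemma memLp_of_continuous {φ : S1 → ℂ} (hφ : Continuous φ) : MemLp φ 2 haarAddCircle := by
  obtain ⟨c, hc⟩ := (isCompact_range hφ).isBounded.exists_norm_le
  exact MemLp.of_bound hφ.aestronglyMeasurable c
    (Filter.Eventually.of_forall fun x => hc _ ⟨x, rfl⟩)

lemma memH1_fourier (n : ℤ) : MemH1 (fourier n : C(S1, ℂ)) :=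
  ⟨memLp_of_continuous (map_continuous _), _,
    memLp_of_continuous (continuous_const.mul (map_continuous _)), hasWeakDeriv_fourier n⟩

lemma memLp_weakDeriv {f : S1 → ℂ} (h : MemH1 f) : MemLp (weakDeriv f) 2 haarAddCircle := by
  rw [weakDeriv, dif_pos h]
  exact h.2.choose_spec.1

lemma hasWeakDeriv_weakDeriv {f : S1 → ℂ} (h : MemH1 f) : HasWeakDeriv f (weakDeriv f) := by
  rw [weakDeriv, dif_pos h]
  exact h.2.choose_spec.2

lemma hasSum_fourierCoeff_mul_conj {f g : S1 → ℂ} (hf : MemLp f 2 haarAddCircle)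
    (hg : MemLp g 2 haarAddCircle) :
    HasSum (fun n => fourierCoeff f n * conj (fourierCoeff g n))
      (∫ x, f x * conj (g x) ∂haarAddCircle) := by
  have h := (fourierBasis (T := 2 * Real.pi)).hasSum_inner_mul_inner (hg.toLp g) (hf.toLp f)
  have hint : inner ℂ (hg.toLp g) (hf.toLp f) = ∫ x, f x * conj (g x) ∂haarAddCircle := by
    rw [L2.inner_def]
    refine integral_congr_ae ?_
    filter_upwards [hf.coeFn_toLp, hg.coeFn_toLp] with x h1 h2
    rw [h1, h2, RCLike.inner_apply]
  rw [hint] at h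
  refine h.congr_fun fun n => ?_
  rw [← inner_conj_symm, ← HilbertBasis.repr_apply_apply, ← HilbertBasis.repr_apply_apply,
    fourierBasis_repr, fourierBasis_repr, fourierCoeff_congr_ae hf.coeFn_toLp,
    fourierCoeff_congr_ae hg.coeFn_toLp, mul_comm]

end Circle

/-! ### The weighted space and the bounded model of the derivative. -/

section Weighted

variable (W : Weight)

lemma Weight.aemeasurable : AEMeasurable (fun x => ENNReal.ofReal (W.w x)) haarAddCircle :=
  W.memW1Inf.1.1.aemeasurable.ennreal_ofReal

/-- The source of the factor `w₋⁻¹`; it also lets a.e. equalities in `L²(w)` pass to Haar measure.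
-/
lemma Weight.haar_le_smul_measure :
    (haarAddCircle : Measure S1) ≤ ENNReal.ofReal W.lower⁻¹ • W.measure := by
  rw [Weight.measure, ← withDensity_smul' _ _ ENNReal.ofReal_ne_top]
  conv_lhs => rw [← withDensity_one (μ := (haarAddCircle : Measure S1))]
  refine withDensity_mono ?_
  filter_upwards [W.lower_le] with x hx
  have := W.lower_pos
  rw [Pi.one_apply, Pi.smul_apply, smul_eq_mul, ← ENNReal.ofReal_mul (by positivity),
    ENNReal.one_le_ofReal, le_inv_mul_iff₀ this]
  linarith

lemma Weight.haar_absolutelyContinuous : (haarAddCircle : Measure S1) ≪ W.measure :=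
  Measure.absolutelyContinuous_of_le_smul W.haar_le_smul_measure

lemma memLp_haar (f : L2 W) : MemLp f 2 haarAddCircle :=
  (Lp.memLp f).of_measure_le_smul ENNReal.ofReal_ne_top W.haar_le_smul_measure

lemma norm_sq_eq_integral (f : L2 W) : ‖f‖ ^ 2 = ∫ x, ‖f x‖ ^ 2 ∂W.measure := by
  have h := congrArg Complex.re (L2.inner_def (𝕜 := ℂ) f f)
  have h2 : ∀ x, inner ℂ (f x) (f x) = ((‖f x‖ ^ 2 : ℝ) : ℂ) := fun x => by
    rw [inner_self_eq_norm_sq_to_K]; norm_cast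
  simp_rw [h2] at h
  rw [integral_complex_ofReal, inner_self_eq_norm_sq_to_K] at h
  exact_mod_cast h

lemma integral_norm_sq_haar_le (f : L2 W) :
    ∫ x, ‖f x‖ ^ 2 ∂haarAddCircle ≤ W.lower⁻¹ * ‖f‖ ^ 2 := by
  have hW := W.lower_pos
  have hint : Integrable (fun x => ‖f x‖ ^ 2) W.measure := (Lp.memLp f).integrable_norm_pow (by simp)
  have h := integral_mono_measure W.haar_le_smul_measure
    (Filter.Eventually.of_forall fun x => sq_nonneg ‖f x‖)
    (hint.smul_measure ENNReal.ofReal_ne_top)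
  rwa [integral_smul_measure, ENNReal.toReal_ofReal (by positivity), ← norm_sq_eq_integral,
    smul_eq_mul] at h

lemma inner_eq_integral (f g : L2 W) :
    inner ℂ g f = ∫ x, f x * conj (g x) * (W.w x : ℂ) ∂haarAddCircle := by
  rw [L2.inner_def]
  refine (integral_withDensity_eq_integral_toReal_smul₀ W.aemeasurable (by simp) _).trans ?_
  refine integral_congr_ae ?_
  filter_upwards [W.lower_le] with x hx
  rw [ENNReal.toReal_ofReal (W.lower_pos.le.trans hx), RCLike.inner_apply, Complex.real_smul,
    mul_comm]

/-- The Fourier coefficient (with respect to `dθ / 2π`), as a linear functional on `L²(w)`. -/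
def fourierFunctional (n : ℤ) : L2 W →ₗ[ℂ] ℂ where
  toFun f := fourierCoeff f n
  map_add' f g := by
    rw [fourierCoeff_congr_ae (W.haar_absolutelyContinuous.ae_eq (Lp.coeFn_add f g)),
      fourierCoeff.add ((memLp_haar W f).integrable (by norm_num))
        ((memLp_haar W g).integrable (by norm_num)), Pi.add_apply]
  map_smul' c f := by
    rw [fourierCoeff_congr_ae (W.haar_absolutelyContinuous.ae_eq (Lp.coeFn_smul c f))]
    exact fourierCoeff.const_smul f c n

lemma fourierFunctional_apply (n : ℤ) (f : L2 W) : fourierFunctional W n f = fourierCoeff f n := rfl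

lemma coeFn_monomial (k : ℕ) : monomial W k =ᵐ[haarAddCircle] fourier (k : ℤ) :=
  W.haar_absolutelyContinuous.ae_eq (ContinuousMap.coeFn_toLp _ _)

lemma fourierFunctional_monomial (n : ℤ) (k : ℕ) :
    fourierFunctional W n (monomial W k) = if n = k then 1 else 0 := by
  rw [fourierFunctional_apply, fourierCoeff_congr_ae (coeFn_monomial W k), fourierCoeff_fourier]
  simp [Pi.single_apply]

lemma linearIndependent_monomial : LinearIndependent ℂ (monomial W) := by
  rw [linearIndependent_iff']
  intro s c hc i hi
  have h := congrArg (fourierFunctional W i) hc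
  simp only [map_sum, map_smul, fourierFunctional_monomial, smul_eq_mul, map_zero, Nat.cast_inj,
    mul_ite, mul_one, mul_zero] at h
  rwa [Finset.sum_ite_eq, if_pos hi] at h

lemma monomial_mem_analyticModes {N k : ℕ} (hk : k ≤ N) : monomial W k ∈ analyticModes W N :=
  Submodule.subset_span ⟨k, hk, rfl⟩

lemma fourierFunctional_eq_zero {N : ℕ} {f : L2 W} (hf : f ∈ analyticModes W N) {n : ℤ}
    (hn : ∀ k : Fin (N + 1), n ≠ (k : ℕ)) : fourierFunctional W n f = 0 := by
  have : analyticModes W N ≤ LinearMap.ker (fourierFunctional W n) := by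
    refine Submodule.span_le.2 ?_
    rintro _ ⟨k, hk, rfl⟩
    rw [SetLike.mem_coe, LinearMap.mem_ker, fourierFunctional_monomial,
      if_neg (hn ⟨k, Nat.lt_succ_of_le hk⟩)]
  exact this hf

/-- The space `H¹(S¹)` inside `L²(w)`. -/
def h1Submodule : Submodule ℂ (L2 W) where
  carrier := {f | MemH1 f}
  add_mem' {f g} hf hg := (MemH1.add hf hg).congr
    (W.haar_absolutelyContinuous.ae_eq (Lp.coeFn_add f g).symm)
  zero_mem' := by
    have h := (memH1_fourier 0).const_smul 0
    rw [zero_smul] at h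
    exact h.congr (W.haar_absolutelyContinuous.ae_eq (Lp.coeFn_zero ℂ 2 W.measure).symm)
  smul_mem' c f hf := (MemH1.const_smul hf c).congr
    (W.haar_absolutelyContinuous.ae_eq (Lp.coeFn_smul c f).symm)

lemma toLp_fourier_mem_h1Submodule (n : ℤ) :
    ContinuousMap.toLp 2 W.measure ℂ (fourier n) ∈ h1Submodule W :=
  (memH1_fourier n).congr
    (W.haar_absolutelyContinuous.ae_eq (ContinuousMap.coeFn_toLp W.measure (fourier n)).symm)

lemma analyticModes_le_h1Submodule (N : ℕ) : analyticModes W N ≤ h1Submodule W := by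
  refine Submodule.span_le.2 ?_
  rintro _ ⟨k, -, rfl⟩
  exact toLp_fourier_mem_h1Submodule W k

/-- Trigonometric polynomials lie in `H¹` and are dense in `L²(w)`. -/
lemma dense_h1Submodule : Dense (h1Submodule W : Set (L2 W)) := by
  have h := (ContinuousMap.toLp_denseRange ℂ W.measure ℂ
    (p := 2) (by simp)).topologicalClosure_map_submodule
      (span_fourier_closure_eq_top (T := 2 * Real.pi))
  rw [Submodule.dense_iff_topologicalClosure_eq_top, eq_top_iff, ← h]
  refine Submodule.topologicalClosure_mono ?_
  rw [Submodule.map_span, Submodule.span_le]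
  rintro _ ⟨_, ⟨n, rfl⟩, rfl⟩
  exact toLp_fourier_mem_h1Submodule W n

/-- The Fourier coefficients of orders `0, …, N`, each multiplied by its order. -/
def modeDerivLinear (N : ℕ) : L2 W →ₗ[ℂ] EuclideanSpace ℂ (Fin (N + 1)) :=
  (WithLp.linearEquiv 2 ℂ (Fin (N + 1) → ℂ)).symm.toLinearMap ∘ₗ
    LinearMap.pi fun n => ((n : ℕ) : ℂ) • fourierFunctional W (n : ℕ)

lemma modeDerivLinear_apply (N : ℕ) (f : L2 W) (n : Fin (N + 1)) :
    modeDerivLinear W N f n = ((n : ℕ) : ℂ) * fourierCoeff f (n : ℕ) := rfl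

/-- Bessel's inequality for `dθ / 2π`, with `n ≤ N`, followed by comparison of the two measures. -/
lemma norm_sq_modeDerivLinear_le (N : ℕ) (f : L2 W) :
    ‖modeDerivLinear W N f‖ ^ 2 ≤ (N : ℝ) ^ 2 / W.lower * ‖f‖ ^ 2 := by
  have hsum := hasSum_sq_fourierCoeff ((memLp_haar W f).toLp f)
  rw [fourierCoeff_congr_ae (memLp_haar W f).coeFn_toLp,
    integral_congr_ae ((memLp_haar W f).coeFn_toLp.mono fun x hx =>
      congrArg (fun z : ℂ => ‖z‖ ^ 2) hx)] at hsum
  have hbes : ∑ n : Fin (N + 1), ‖fourierCoeff f ((n : ℕ) : ℤ)‖ ^ 2 ≤ W.lower⁻¹ * ‖f‖ ^ 2 := by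
    refine le_trans ?_ (integral_norm_sq_haar_le W f)
    have hinj : Function.Injective fun n : Fin (N + 1) => ((n : ℕ) : ℤ) :=
      Nat.cast_injective.comp Fin.val_injective
    have := sum_le_hasSum (Finset.univ.map ⟨_, hinj⟩) (fun i _ => sq_nonneg _) hsum
    rwa [Finset.sum_map] at this
  rw [EuclideanSpace.norm_sq_eq]
  calc ∑ n, ‖modeDerivLinear W N f n‖ ^ 2
      ≤ ∑ n : Fin (N + 1), (N : ℝ) ^ 2 * ‖fourierCoeff f ((n : ℕ) : ℤ)‖ ^ 2 := by
        refine Finset.sum_le_sum fun n _ => ?_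
        rw [modeDerivLinear_apply, norm_mul, mul_pow, Complex.norm_natCast]
        gcongr
        exact Nat.lt_succ_iff.1 n.2
    _ ≤ (N : ℝ) ^ 2 * (W.lower⁻¹ * ‖f‖ ^ 2) := by
        rw [← Finset.mul_sum]
        gcongr
    _ = (N : ℝ) ^ 2 / W.lower * ‖f‖ ^ 2 := by ring

/-- The bounded operator `f ↦ (n a_n(f))_{0 ≤ n ≤ N}` on `L²(w)`. -/
def modeDeriv (N : ℕ) : L2 W →L[ℂ] EuclideanSpace ℂ (Fin (N + 1)) :=
  (modeDerivLinear W N).mkContinuous (Real.sqrt ((N : ℝ) ^ 2 / W.lower)) fun f => by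
    have := W.lower_pos
    refine abs_le_of_sq_le_sq' ?_ (by positivity) |>.2
    rw [mul_pow, Real.sq_sqrt (by positivity)]
    exact norm_sq_modeDerivLinear_le W N f

/-- In Parseval's sum the coefficients of `g'` vanish outside `0, …, N`, so `f` need only be in
`H¹`. -/
lemma sobolevInner_eq_perturbedInner (lam : ℝ) {N : ℕ} {f g : L2 W} (hf : MemH1 f)
    (hg : g ∈ analyticModes W N) :
    sobolevInner W lam f g = perturbedInner (modeDeriv W N) lam f g := by
  have hg1 : MemH1 g := analyticModes_le_h1Submodule W N hg
  rw [sobolevInner, perturbedInner, inner_eq_integral]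
  congr 2
  have hinj : Function.Injective fun n : Fin (N + 1) => ((n : ℕ) : ℤ) :=
    Nat.cast_injective.comp Fin.val_injective
  have hsum := hasSum_fourierCoeff_mul_conj (memLp_weakDeriv hf) (memLp_weakDeriv hg1)
  rw [← hinj.hasSum_iff] at hsum
  · rw [hsum.unique (hasSum_fintype _), PiLp.inner_apply]
    refine Finset.sum_congr rfl fun n _ => ?_
    rw [Function.comp_apply, fourierCoeff_eq_of_hasWeakDeriv (hasWeakDeriv_weakDeriv hf),
      fourierCoeff_eq_of_hasWeakDeriv (hasWeakDeriv_weakDeriv hg1), RCLike.inner_apply]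
    change _ = modeDerivLinear W N f n * conj (modeDerivLinear W N g n)
    rw [modeDerivLinear_apply, modeDerivLinear_apply]
    simp only [map_mul, Complex.conj_I, Complex.conj_natCast, Int.cast_natCast]
    -- The factors `I` and `conj I` multiply to `1`, which is why `modeDerivLinear` omits `I`.
    linear_combination (-(n : ℕ) * fourierCoeff f (n : ℕ) * ((n : ℕ) *
      conj (fourierCoeff g (n : ℕ))) : ℂ) * Complex.I_mul_I
  · intro n hn
    have h0 : fourierCoeff g n = 0 :=
      fourierFunctional_eq_zero W hg fun k hk => hn ⟨k, hk.symm⟩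
    rw [fourierCoeff_eq_of_hasWeakDeriv (hasWeakDeriv_weakDeriv hg1), h0]
    simp

lemma sobolevOpuc_eq (lam : ℝ) {N k : ℕ} (hk : k ≤ N) :
    sobolevOpuc W lam k = gramSchmidtFormNormed (perturbedInner (modeDeriv W N) lam)
      (monomial W) k := by
  have hv : ∀ i ≤ k, monomial W i ∈ analyticModes W N := fun i hi =>
    monomial_mem_analyticModes W (hi.trans hk)
  have hB : ∀ f ∈ analyticModes W N, ∀ g ∈ analyticModes W N,
      sobolevInner W lam f g = perturbedInner (modeDeriv W N) lam f g := fun f hf g hg =>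
    sobolevInner_eq_perturbedInner W lam (analyticModes_le_h1Submodule W N hf) hg
  have hmem := gramSchmidtForm_mem (perturbedInner (modeDeriv W N) lam) (monomial W) _ k hv
  rw [sobolevOpuc, gramSchmidtFormNormed, gramSchmidtFormNormed,
    gramSchmidtForm_congr (monomial W) _ hB k hv, hB _ hmem _ hmem]

lemma norm_sobolevOpuc_sub_opuc_le {lam : ℝ} (hlam : 0 ≤ lam) {N k : ℕ} (hk : k ≤ N) :
    ‖sobolevOpuc W lam k - opuc W k‖ ≤ 2 * ((N : ℝ) ^ 2 / W.lower) * lam := by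
  have := W.lower_pos
  rw [sobolevOpuc_eq W lam hk]
  exact norm_gramSchmidtFormNormed_sub_le (modeDeriv W N) hlam (by positivity)
    (norm_sq_modeDerivLinear_le W N) (linearIndependent_monomial W) k

lemma IsSobolevProjector.perturbedInner_eq_zero {W : Weight} {lam : ℝ} {N : ℕ}
    {P : L2 W →L[ℂ] L2 W} (hP : IsSobolevProjector W lam N P) {f g : L2 W} (hf : MemH1 f)
    (hg : g ∈ analyticModes W N) : perturbedInner (modeDeriv W N) lam (f - P f) g = 0 := by
  rw [← sobolevInner_eq_perturbedInner W lam _ hg]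
  · exact hP.2 f hf g hg
  · exact (h1Submodule W).sub_mem hf (analyticModes_le_h1Submodule W N (hP.1 f))

/-- On `H¹` the difference of two projectors takes values orthogonal to themselves, hence zero;
density and continuity do the rest. -/
lemma IsSobolevProjector.unique {W : Weight} {lam : ℝ} (hlam : 0 ≤ lam) {N : ℕ}
    {P Q : L2 W →L[ℂ] L2 W} (hP : IsSobolevProjector W lam N P)
    (hQ : IsSobolevProjector W lam N Q) : Q = P := by
  refine ContinuousLinearMap.coeFn_injective
    (Q.continuous.ext_on (dense_h1Submodule W) P.continuous fun f hf => ?_)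
  have hmem := (analyticModes W N).sub_mem (hQ.1 f) (hP.1 f)
  refine sub_eq_zero.1 (eq_zero_of_perturbedInner_self (modeDeriv W N) hlam ?_)
  have h : Q f - P f = (f - P f) - (f - Q f) := by abel
  conv_lhs => arg 3; rw [h]
  rw [perturbedInner_sub_left, hP.perturbedInner_eq_zero hf hmem,
    hQ.perturbedInner_eq_zero hf hmem, sub_zero]

lemma exists_isSobolevProjector {lam : ℝ} (hlam : 0 ≤ lam) (N : ℕ) :
    ∃ P : L2 W →L[ℂ] L2 W, IsSobolevProjector W lam N P ∧
      ‖P - (analyticModes W N).starProjection‖ ≤ (N : ℝ) ^ 2 / W.lower * lam := by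
  have := W.lower_pos
  obtain ⟨P, hmem, horth, hnorm⟩ := exists_perturbed_projector (modeDeriv W N) hlam
    (M := (N : ℝ) ^ 2 / W.lower) (by positivity) (norm_sq_modeDerivLinear_le W N)
    (analyticModes W N)
  refine ⟨P, ⟨hmem, fun f hf g hg => ?_⟩, hnorm⟩
  rw [sobolevInner_eq_perturbedInner W lam _ hg]
  · exact horth f g hg
  · exact (h1Submodule W).sub_mem hf (analyticModes_le_h1Submodule W N (hmem f))

lemma Weight.upper_pos : 0 < W.upper := by
  obtain ⟨x, h1, h2⟩ := (W.lower_le.and W.le_upper).exists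
  exact W.lower_pos.trans_le (h1.trans h2)

lemma sq_div_lower_le_finiteDegreeConst (N : ℕ) :
    (N : ℝ) ^ 2 / W.lower ≤ finiteDegreeConst W N := by
  have h1 := W.lower_pos
  have h2 := W.upper_pos
  have h3 : (N : ℝ) ^ 2 ≤ (N : ℝ) ^ 4 := by
    rcases Nat.eq_zero_or_pos N with rfl | hN
    · norm_num
    · exact_mod_cast Nat.pow_le_pow_right hN (by norm_num)
  rw [finiteDegreeConst, div_eq_mul_one_div]
  have h4 : 0 ≤ W.upper / W.lower ^ 2 := by positivity
  have h5 : 1 / W.lower ≤ W.upper / W.lower ^ 2 + 1 / W.lower := by linarith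
  exact mul_le_mul h3 h5 (by positivity) (by positivity)

end Weighted

end SobolevOPUC
end
open SobolevOPUC in
theorem mainTheorem5 :
    ∃ K : ℝ, 0 < K ∧ ∀ (W : Weight) (N : ℕ),
      ∃ C : ℝ, 0 ≤ C ∧ (1 ≤ N → 0 < C) ∧ C ≤ K * finiteDegreeConst W N ∧
        (∀ lam : ℝ, 0 < lam →
          ∃ P : L2 W →L[ℂ] L2 W,
            IsSobolevProjector W lam N P ∧
            (∀ Q : L2 W →L[ℂ] L2 W, IsSobolevProjector W lam N Q → Q = P) ∧
            ‖P - (analyticModes W N).starProjection‖ ≤ C * lam) ∧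
        ∃ U : Matrix.unitaryGroup (Fin (N + 1)) ℂ,
          ∀ lam : ℝ, 0 < lam → ∀ k : Fin (N + 1),
            ‖sobolevOpuc W lam k - ∑ j : Fin (N + 1), (U : Matrix _ _ ℂ) k j • opuc W j‖
              ≤ C * lam := by
  refine ⟨2, two_pos, fun W N => ?_⟩
  have hlow := W.lower_pos
  have hC : 0 ≤ (N : ℝ) ^ 2 / W.lower := by positivity
  -- The factor `2` is needed for the polynomials only. The unitary matrix is `1`.
  refine ⟨2 * ((N : ℝ) ^ 2 / W.lower), by positivity, fun hN => ?_, ?_, fun lam hlam => ?_, 1,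
    fun lam hlam k => ?_⟩
  · have : (0 : ℝ) < N := by exact_mod_cast hN
    positivity
  · exact mul_le_mul_of_nonneg_left (sq_div_lower_le_finiteDegreeConst W N) zero_le_two
  · obtain ⟨P, hP, hnorm⟩ := exists_isSobolevProjector W hlam.le N
    exact ⟨P, hP, fun Q hQ => hP.unique hlam.le hQ,
      hnorm.trans (mul_le_mul_of_nonneg_right (by linarith) hlam.le)⟩
  · have h := norm_sobolevOpuc_sub_opuc_le W hlam.le (Nat.lt_succ_iff.1 k.2)
    simpa [Matrix.one_apply] using h
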